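/- Let $q$ be a prime power. **Definitions.** An $[[n,\kappa,r,\delta]]_q$ subsystem code is a subspace $Q$ of $(\mathbb{C}^q)^{\otimes n}$ together with a decomposition $Q = A\otimes B$ as a Hilbert space, where $\dim A = q^{\kappa}$ and $\dim B = q^{r}$, whose minimum distance is $\delta$. Here, with $P$ the orthogonal projection onto $Q$, an operator $E$ on $(\mathbb{C}^q)^{\otimes n}$ is detectable if $PEP$ acts on $Q=A\otimes B$ as $1_A\otimes G$ for some operator $G$ on $B$; the minimum distance is $\delta$ if every operator acting on fewer than $\delta$ of the $n$ tensor factors is detectable and some operator acting on $\delta$ of them is not. The code is optimal if it attains equality in the Singleton-like bound $\kappa+r\le n-2\delta+2$. **Theorem.** Optimal subsystem codes with the following parameters $[[n,\kappa,r,\delta]]_q$ exist. For every $s\in\{0,1,\dots,q-1\}$: 1. $[[\,q^2-s,\ q^2-2q+1,\ 1+s,\ q-s\,]]_q$ 2. $[[\,q^2-s,\ q^2-2q+1+s,\ 1,\ q-s\,]]_q$ For every integer $k$ with $1<k<q$ and every $s\in\{0,1,\dots,k-1\}$: 3. $[[\,q^2-1-s,\ q^2-2k,\ 1+s,\ k-s\,]]_q$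 4. $[[\,q^2-1-s,\ q^2-2k+s,\ 1,\ k-s\,]]_q$ and, with $i=\gcd(k-1,q-1)$: 5. $[[\,q^2-i(q+1)-s,\ q^2-i(q+1)-2k+1,\ 1+s,\ k-s\,]]_q$ 6. $[[\,q^2-i(q+1)-s,\ q^2-i(q+1)-2k+1+s,\ 1,\ k-s\,]]_q$ If moreover $m$ is an integer with $k-1<m<q-1$ and $j=\gcd(m-k+1,q-1)$, then for every $s\in\{0,1,\dots,k-1\}$: 7. $[[\,q^2-j(q+1)-1-s,\ q^2-j(q+1)-2k,\ 1+s,\ k-s\,]]_q$ 8. $[[\,q^2-j(q+1)-1-s,\ q^2-j(q+1)-2k+s,\ 1,\ k-s\,]]_q$ -/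

import Mathlib

open scoped TensorProduct

/-- The state space `(ℂ^q)^{⊗ n}` of `n` qudits, written in its computational orthonormal basis
`|x₁⟩ ⊗ ⋯ ⊗ |xₙ⟩`, `x ∈ {0, …, q-1}ⁿ`, with its standard inner product. -/
abbrev QuditSpace (q n : ℕ) : Type := EuclideanSpace ℂ (Fin n → Fin q)

/-- The word that is equal to `u` at the positions in `T` and to `x` at all other positions. -/
def overwrite {q n : ℕ} (T : Finset (Fin n)) (u : T → Fin q) (x : Fin n → Fin q) : Fin n → Fin q :=
  fun i => if h : i ∈ T then u ⟨i, h⟩ else x i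

/-- The error operator `E` affects only the qudits at the positions in `T`: it is `F ⊗ 1` with `F`
an arbitrary operator on the qudits in `T` and `1` the identity on all the other qudits. -/
def AffectsOnly {q n : ℕ} (T : Finset (Fin n)) (E : QuditSpace q n →ₗ[ℂ] QuditSpace q n) : Prop :=
  ∃ F : Matrix (T → Fin q) (T → Fin q) ℂ, ∀ (ψ : QuditSpace q n) (x : Fin n → Fin q),
    E ψ x = ∑ u : T → Fin q, F (fun i => x i) u * ψ (overwrite T u x)

/-- A quantum subsystem code: a subspace of `(ℂ^q)^{⊗ n}` together with a decomposition (as a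
Hilbert space) into a tensor product `A ⊗ B` of a `K`-dimensional space `A` (the subsystem that
stores the information) and an `R`-dimensional space `B` (the gauge subsystem). -/
structure SubsystemCode (q n K R : ℕ) where
  /-- the code space -/
  space : Submodule ℂ (QuditSpace q n)
  /-- the identification of `A ⊗ B` with the code space -/
  split : EuclideanSpace ℂ (Fin K) ⊗[ℂ] EuclideanSpace ℂ (Fin R) ≃ₗᵢ[ℂ] space

namespace SubsystemCode

variable {q n K R : ℕ}

/-- The error operator `E` is detectable by the subsystem `A`: with `P` the orthogonal projection
onto the code space, `P E P = 1_A ⊗ G` on `A ⊗ B`, for some operator `G` on the gauge subsystem. -/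
def Detects (Q : SubsystemCode q n K R) (E : QuditSpace q n →ₗ[ℂ] QuditSpace q n) : Prop :=
  ∃ G : EuclideanSpace ℂ (Fin R) →ₗ[ℂ] EuclideanSpace ℂ (Fin R),
    ∀ t : EuclideanSpace ℂ (Fin K) ⊗[ℂ] EuclideanSpace ℂ (Fin R),
      Q.space.orthogonalProjectionOnto (E (Q.split t)) =
        Q.split (TensorProduct.map LinearMap.id G t)

/-- The minimum distance of the code is `δ`: every error operator that affects fewer than `δ`
qudits is detectable, and some error operator that affects `δ` qudits is not. (By the
Knill-Laflamme type condition for subsystem codes, all errors on at most `⌊(δ-1)/2⌋` qudits can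
then be corrected on `A`.) -/
def HasMinDist (Q : SubsystemCode q n K R) (δ : ℕ) : Prop :=
  (∀ (T : Finset (Fin n)) (E : QuditSpace q n →ₗ[ℂ] QuditSpace q n),
    T.card < δ → AffectsOnly T E → Q.Detects E) ∧
  ∃ (T : Finset (Fin n)) (E : QuditSpace q n →ₗ[ℂ] QuditSpace q n),
    T.card = δ ∧ AffectsOnly T E ∧ ¬ Q.Detects E

end SubsystemCode

/-- There is an `[[n, κ, r, δ]]_q` subsystem code: a subsystem code in `(ℂ^q)^{⊗ n}` with
`dim A = q ^ κ`, `dim B = q ^ r` and minimum distance `δ`. The parameters are given as integers, and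
that they are natural numbers is part of the assertion. -/
def ExistsSubsystemCode (q : ℕ) (n κ r δ : ℤ) : Prop :=
  ∃ n' κ' r' δ' : ℕ, (n' : ℤ) = n ∧ (κ' : ℤ) = κ ∧ (r' : ℤ) = r ∧ (δ' : ℤ) = δ ∧
    ∃ Q : SubsystemCode q n' (q ^ κ') (q ^ r'), Q.HasMinDist δ'

/-- There is an optimal `[[n, κ, r, δ]]_q` subsystem code, that is, one whose parameters reach
equality in the Singleton-like bound `κ + r ≤ n - 2 δ + 2`. -/
def ExistsOptimalSubsystemCode (q : ℕ) (n κ r δ : ℤ) : Prop :=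
  ExistsSubsystemCode q n κ r δ ∧ κ + r = n - 2 * δ + 2

/-! Let F ⊂ K be the fields with q and q² elements and N the norm x ↦ x^(q+1). For U ∈ F[X], take as
evaluation points the x ∈ K with U(N x) ≠ 0, and weights w_x with N(w_x) = U(N x). The Hermitian
product of the words (w_x p(x)) and (w_x p'(x)), deg p, deg p' < d, is the sum over K of U(N x) p(x)
p'(x)^q, a polynomial in x of degree at most (deg U + d - 1)(q + 1). If deg U + d < q this is below
q² - 1, so the sum vanishes and the code is self-orthogonal. Restricting to polynomials that vanish
at s chosen points, and deleting those points, lowers length, dimension and dual distance by s each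
(`exists_subsystemCode_of_normPolynomial`).

In suitable F-coordinates on K, Hermitian self-orthogonality implies symplectic isotropy
(`exists_subsystemCode_of_grs`). Let D be the resulting isotropic F-space. In
`exists_subsystemCode_of_isotropic`, Weyl operators of a Lagrangian L ⊇ D have a common eigenvector,
whose translates by representatives of D^⊥ / L form an orthonormal basis of the code. Splitting the
q-ary labels of this basis into κ and r digits gives A ⊗ B. Since D^⊥ meets the Singleton bound, the
distance does not depend on the split, so r = 1 + s and r = 1 come from the same D.

The families use U = 1, X, 1 - X^(q-k) and X(1 - X^(m-k+1)); cyclicity of the unit group of K counts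
the points. -/

/-! ### Common eigenvectors and orthogonality of eigenvectors. -/

/-- A commuting family of operators on a nonzero finite-dimensional complex space has a common
eigenvector. -/
lemma exists_common_eigenvector {ι E : Type*} [AddCommGroup E] [Module ℂ E]
    [FiniteDimensional ℂ E] [Nontrivial E] (f : ι → Module.End ℂ E)
    (hf : ∀ i j, Commute (f i) (f j)) :
    ∃ φ : E, φ ≠ 0 ∧ ∃ c : ι → ℂ, ∀ i, f i φ = c i • φ := by
  -- On a minimal nonzero invariant subspace every member of the family is scalar: by commutativity
  -- its eigenspace there is again invariant.
  obtain ⟨p, ⟨hp0, hpf⟩, hmin⟩ := IsArtinian.set_has_minimal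
    {p : Submodule ℂ E | p ≠ ⊥ ∧ ∀ i, p ≤ p.comap (f i)} ⟨⊤, top_ne_bot, fun i => by simp⟩
  have key : ∀ i, ∃ c : ℂ, ∀ φ ∈ p, f i φ = c • φ := by
    intro i
    have : Nontrivial p := Submodule.nontrivial_iff_ne_bot.mpr hp0
    obtain ⟨μ, hμ⟩ := Module.End.exists_eigenvalue ((f i).restrict (hpf i))
    obtain ⟨⟨φ, hφp⟩, hφ⟩ := hμ.exists_hasEigenvector
    have hφ1 : f i φ = μ • φ := congrArg Subtype.val hφ.apply_eq_smul
    have hφ0 : φ ≠ 0 := fun h => hφ.2 (Subtype.ext h)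
    refine ⟨μ, ?_⟩
    have hle : p ⊓ Module.End.eigenspace (f i) μ ≤ p := inf_le_left
    have hmem : p ⊓ Module.End.eigenspace (f i) μ ∈
        {p : Submodule ℂ E | p ≠ ⊥ ∧ ∀ i, p ≤ p.comap (f i)} := by
      refine ⟨fun h => hφ0 ?_, fun j ψ hψ => ?_⟩
      · rw [← Submodule.mem_bot ℂ, ← h]
        exact ⟨hφp, Module.End.mem_eigenspace_iff.mpr hφ1⟩
      · refine ⟨hpf j hψ.1, Module.End.mem_eigenspace_iff.mpr ?_⟩
        rw [← Module.End.mul_apply, (hf i j).eq, Module.End.mul_apply,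
          Module.End.mem_eigenspace_iff.mp hψ.2, map_smul]
    have heq := eq_of_le_of_not_lt hle (hmin _ hmem)
    intro ψ hψ
    rw [← heq] at hψ
    exact Module.End.mem_eigenspace_iff.mp hψ.2
  choose c hc using key
  obtain ⟨φ, hφp, hφ0⟩ := Submodule.exists_mem_ne_zero_of_ne_bot hp0
  exact ⟨φ, hφ0, c, fun i => hc i φ hφp⟩

/-- Eigenvectors of an isometry for different eigenvalues are orthogonal. -/
lemma inner_eq_zero_of_isometry_eigenvalue_ne {E : Type*} [NormedAddCommGroup E]
    [InnerProductSpace ℂ E] (U : E →ₗ[ℂ] E) (hU : ∀ a b, inner ℂ (U a) (U b) = inner ℂ a b)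
    {a b : E} {α β : ℂ} (ha : U a = α • a) (hb : U b = β • b) (h : α ≠ β) :
    inner ℂ a b = 0 := by
  by_cases ha0 : a = 0
  · simp [ha0]
  have h1 := hU a a
  have h2 := hU a b
  rw [ha, inner_smul_left, inner_smul_right] at h1
  rw [ha, hb, inner_smul_left, inner_smul_right] at h2
  have hαα : (starRingEnd ℂ) α * α = 1 := by
    have : inner ℂ a a ≠ (0 : ℂ) := inner_self_ne_zero.mpr ha0
    apply mul_right_cancel₀ this
    rw [one_mul, mul_assoc, h1]
  by_contra hab
  have hαβ : (starRingEnd ℂ) α * β = 1 := by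
    apply mul_right_cancel₀ hab
    rw [one_mul, mul_assoc, h2]
  have hα0 : (starRingEnd ℂ) α ≠ 0 := left_ne_zero_of_mul_eq_one hαα
  exact h (mul_left_cancel₀ hα0 (hαα.trans hαβ.symm))

/-! ### Symplectic linear algebra -/

/-- The standard symplectic form on `(F × F)ⁿ`. -/
def symplecticForm (F : Type*) [Field F] (n : ℕ) : LinearMap.BilinForm F (Fin n → F × F) :=
  LinearMap.mk₂ F (fun u v => ∑ i, ((u i).1 * (v i).2 - (u i).2 * (v i).1))
    (fun u u' v => by
      rw [← Finset.sum_add_distrib]; refine Finset.sum_congr rfl fun i _ => ?_; simp; ring)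
    (fun c u v => by
      rw [Finset.smul_sum]; refine Finset.sum_congr rfl fun i _ => ?_; simp; ring)
    (fun u v v' => by
      rw [← Finset.sum_add_distrib]; refine Finset.sum_congr rfl fun i _ => ?_; simp; ring)
    (fun c u v => by
      rw [Finset.smul_sum]; refine Finset.sum_congr rfl fun i _ => ?_; simp; ring)

section Symplectic

variable {F : Type*} [Field F] {n : ℕ}

lemma symplecticForm_apply (u v : Fin n → F × F) :
    symplecticForm F n u v = ∑ i, ((u i).1 * (v i).2 - (u i).2 * (v i).1) := rfl

lemma symplecticForm_self (u : Fin n → F × F) : symplecticForm F n u u = 0 := by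
  rw [symplecticForm_apply]
  exact Finset.sum_eq_zero fun i _ => by ring

lemma symplecticForm_swap (u v : Fin n → F × F) :
    symplecticForm F n u v = -symplecticForm F n v u := by
  rw [symplecticForm_apply, symplecticForm_apply, ← Finset.sum_neg_distrib]
  exact Finset.sum_congr rfl fun i _ => by ring

lemma symplecticForm_single_left (i : Fin n) (a : F × F) (v : Fin n → F × F) :
    symplecticForm F n (Pi.single i a) v = a.1 * (v i).2 - a.2 * (v i).1 := by
  rw [symplecticForm_apply, Finset.sum_eq_single i]
  · simp
  · intro j _ hj
    simp [Pi.single_eq_of_ne hj]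
  · simp

lemma symplecticForm_nondegenerate : (symplecticForm F n).Nondegenerate := by
  have key : ∀ v : Fin n → F × F, (∀ u, symplecticForm F n u v = 0) → v = 0 := by
    intro v hv
    funext i
    have h1 := hv (Pi.single i (1, 0))
    have h2 := hv (Pi.single i (0, 1))
    rw [symplecticForm_single_left] at h1 h2
    refine Prod.ext ?_ ?_
    · simpa using h2
    · simpa using h1
  exact ⟨fun v hv => key v fun u => by rw [symplecticForm_swap, hv, neg_zero], key⟩

lemma finrank_prod_pi (ι : Type*) [Fintype ι] : Module.finrank F (ι → F × F) = 2 * Fintype.card ι := by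
  rw [Module.finrank_pi_fintype]
  simp [mul_comm]

/-- Every isotropic subspace lies in a Lagrangian one. -/
lemma exists_lagrangian (D : Submodule F (Fin n → F × F))
    (hD : D ≤ (symplecticForm F n).orthogonal D) :
    ∃ L, D ≤ L ∧ (symplecticForm F n).orthogonal L = L := by
  obtain ⟨L, ⟨hDL, hL⟩, hmax⟩ := set_has_maximal_iff_noetherian.mpr
    (inferInstance : IsNoetherian F (Fin n → F × F))
    {L | D ≤ L ∧ L ≤ (symplecticForm F n).orthogonal L} ⟨D, le_rfl, hD⟩
  refine ⟨L, hDL, le_antisymm (fun v hv => ?_) hL⟩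
  -- `L` is a maximal isotropic subspace. Because the form is alternating, adjoining a vector
  -- orthogonal to `L` keeps it isotropic, so the vector was already in `L`.
  have hmem : L ⊔ F ∙ v ∈ {L | D ≤ L ∧ L ≤ (symplecticForm F n).orthogonal L} := by
    refine ⟨hDL.trans le_sup_left, ?_⟩
    rw [sup_le_iff]
    have hvL : ∀ l ∈ L, symplecticForm F n l v = 0 := fun l hl => hv l hl
    constructor
    · intro l hl m hm
      obtain ⟨l', hl', w, hw, rfl⟩ := Submodule.mem_sup.mp hm
      obtain ⟨c, rfl⟩ := Submodule.mem_span_singleton.mp hw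
      change symplecticForm F n (l' + c • v) l = 0
      rw [map_add, LinearMap.add_apply, map_smul, LinearMap.smul_apply, symplecticForm_swap v l,
        hvL l hl, show symplecticForm F n l' l = 0 from hL hl l' hl']
      simp
    · rw [Submodule.span_singleton_le_iff_mem]
      intro m hm
      obtain ⟨l', hl', w, hw, rfl⟩ := Submodule.mem_sup.mp hm
      obtain ⟨c, rfl⟩ := Submodule.mem_span_singleton.mp hw
      change symplecticForm F n (l' + c • v) v = 0
      rw [map_add, LinearMap.add_apply, map_smul, LinearMap.smul_apply, symplecticForm_self,
        hvL l' hl']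
      simp
  have heq := eq_of_le_of_not_lt (le_sup_left : L ≤ L ⊔ F ∙ v) (hmax _ hmem)
  rw [heq]
  exact Submodule.mem_sup_right (Submodule.mem_span_singleton_self v)

lemma finrank_lagrangian {L : Submodule F (Fin n → F × F)}
    (hL : (symplecticForm F n).orthogonal L = L) : Module.finrank F L = n := by
  have h := LinearMap.BilinForm.finrank_orthogonal symplecticForm_nondegenerate L
  have h2 := Submodule.finrank_le L
  rw [hL] at h
  rw [finrank_prod_pi, Fintype.card_fin] at h h2
  omega

/-- Coordinates `g` on a Lagrangian subspace `L` modulo its subspace `D`, and the vectors `f z`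
representing the functionals `z ⬝ g`. -/
lemma exists_logical_frame {κ r : ℕ} (D : Submodule F (Fin n → F × F))
    (hD : D ≤ (symplecticForm F n).orthogonal D) (hdim : Module.finrank F D + κ + r = n) :
    ∃ (L : Submodule F (Fin n → F × F)) (g : (Fin n → F × F) →ₗ[F] (Fin κ → F) × (Fin r → F))
      (f : (Fin κ → F) × (Fin r → F) →ₗ[F] (Fin n → F × F)),
      D ≤ L ∧ (symplecticForm F n).orthogonal L = L ∧ (∀ z, ∃ l ∈ L, g l = z) ∧
      (∀ d ∈ D, g d = 0) ∧
      (∀ v z, symplecticForm F n v (f z) = (g v).1 ⬝ᵥ z.1 + (g v).2 ⬝ᵥ z.2) ∧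
      ∀ v ∈ (symplecticForm F n).orthogonal D, ∃ z, ∃ l ∈ L, v = f z + l := by
  obtain ⟨L, hDL, hL⟩ := exists_lagrangian D hD
  have hLn := finrank_lagrangian hL
  have hD' : Module.finrank F (D.comap L.subtype) = Module.finrank F D :=
    (Submodule.comapSubtypeEquivOfLe hDL).finrank_eq
  have hq : Module.finrank F (L ⧸ D.comap L.subtype) =
      Module.finrank F ((Fin κ → F) × (Fin r → F)) := by
    have := (D.comap L.subtype).finrank_quotient_add_finrank
    rw [hD', hLn] at this
    rw [Module.finrank_prod, Module.finrank_fin_fun, Module.finrank_fin_fun]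
    omega
  let E := LinearEquiv.ofFinrankEq _ _ hq
  obtain ⟨g, hg⟩ := LinearMap.exists_extend (E.toLinearMap ∘ₗ (D.comap L.subtype).mkQ)
  have hgL : ∀ l : L, g l = E ((D.comap L.subtype).mkQ l) := fun l => LinearMap.congr_fun hg l
  have hgs : ∀ z, ∃ l ∈ L, g l = z := by
    intro z
    obtain ⟨l, hl⟩ := Submodule.mkQ_surjective _ (E.symm z)
    exact ⟨l, l.2, by rw [hgL, hl, E.apply_symm_apply]⟩
  have hgD : ∀ l ∈ L, g l = 0 ↔ l ∈ D := by
    intro l hl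
    rw [hgL ⟨l, hl⟩, LinearEquiv.map_eq_zero_iff, Submodule.mkQ_apply,
      Submodule.Quotient.mk_eq_zero]
    rfl
  let dot : (Fin κ → F) × (Fin r → F) →ₗ[F] Module.Dual F ((Fin κ → F) × (Fin r → F)) :=
    LinearMap.mk₂ F (fun z w => w.1 ⬝ᵥ z.1 + w.2 ⬝ᵥ z.2)
      (fun a b c => by simp [dotProduct_add]; ring) (fun a b c => by simp [mul_add])
      (fun a b c => by simp [add_dotProduct]; ring) (fun a b c => by simp [mul_add])
  let B := (symplecticForm F n).toDual symplecticForm_nondegenerate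
  let f : (Fin κ → F) × (Fin r → F) →ₗ[F] (Fin n → F × F) :=
    -- The sign moves the representing vector from the left argument of the form to the right one.
    -(B.symm.toLinearMap ∘ₗ (LinearMap.lcomp F F g) ∘ₗ dot)
  have hf : ∀ v z, symplecticForm F n v (f z) = (g v).1 ⬝ᵥ z.1 + (g v).2 ⬝ᵥ z.2 := by
    intro v z
    rw [symplecticForm_swap]
    have : symplecticForm F n (B.symm ((LinearMap.lcomp F F g) (dot z))) v = _ :=
      LinearMap.BilinForm.apply_toDual_symm_apply (hB := symplecticForm_nondegenerate) _ v
    change -symplecticForm F n (-(B.symm ((LinearMap.lcomp F F g) (dot z)))) v = _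
    rw [map_neg, LinearMap.neg_apply, neg_neg, this]
    rfl
  refine ⟨L, g, f, hDL, hL, hgs, fun d hd => (hgD d (hDL hd)).mpr hd, hf, ?_⟩
  have hfL : ∀ z, f z ∈ L → z = 0 := by
    intro z hz
    have h0 : ∀ w : (Fin κ → F) × (Fin r → F), w.1 ⬝ᵥ z.1 + w.2 ⬝ᵥ z.2 = 0 := by
      intro w
      obtain ⟨l, hl, rfl⟩ := hgs w
      rw [← hf]
      rw [← hL] at hz
      exact hz l hl
    refine Prod.ext ?_ ?_
    · exact dotProduct_eq_zero _ fun w => by simpa [dotProduct_comm] using h0 (w, 0)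
    · exact dotProduct_eq_zero _ fun w => by simpa [dotProduct_comm] using h0 (0, w)
  have hinj : Function.Injective (f.coprod L.subtype) := by
    rw [← LinearMap.ker_eq_bot, LinearMap.ker_eq_bot']
    rintro ⟨z, l⟩ h
    have h : f z + (l : Fin n → F × F) = 0 := by simpa using h
    have hz : z = 0 := hfL z (by rw [eq_neg_of_add_eq_zero_left h]; exact L.neg_mem l.2)
    subst hz
    rw [map_zero, zero_add] at h
    exact Prod.ext rfl (Subtype.ext h)
  -- The image of `f` is complementary to `L` inside D^⊥: both lie there, they meet in 0, and the
  -- dimensions (κ + r) + n and 2n - dim D agree.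
  have hrange : LinearMap.range (f.coprod L.subtype) = (symplecticForm F n).orthogonal D := by
    refine Submodule.eq_of_le_of_finrank_eq ?_ ?_
    · rintro _ ⟨⟨z, l⟩, rfl⟩ d hd
      have h1 : symplecticForm F n d l = 0 := by
        have hl : (l : Fin n → F × F) ∈ (symplecticForm F n).orthogonal L := hL.ge l.2
        exact hl d (hDL hd)
      change symplecticForm F n d (f z + l) = 0
      rw [map_add, h1, hf, (hgD d (hDL hd)).mpr hd]
      simp
    · rw [LinearMap.finrank_range_of_inj hinj,
        LinearMap.BilinForm.finrank_orthogonal symplecticForm_nondegenerate, finrank_prod_pi,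
        Module.finrank_prod, Module.finrank_prod, Module.finrank_fin_fun, Module.finrank_fin_fun,
        hLn, Fintype.card_fin]
      omega
  intro v hv
  rw [← hrange] at hv
  obtain ⟨⟨z, l⟩, rfl⟩ := hv
  exact ⟨z, l, l.2, rfl⟩

end Symplectic

/-! ### Weyl operators. -/

lemma AddChar.map_sum_eq_prod_apply {ι A M : Type*} [AddCommMonoid A] [CommMonoid M] (χ : AddChar A M)
    (s : Finset ι) (f : ι → A) : χ (∑ i ∈ s, f i) = ∏ i ∈ s, χ (f i) := by
  classical
  induction s using Finset.induction_on with
  | empty => simp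
  | insert i s hi ih =>
    rw [Finset.sum_insert hi, Finset.prod_insert hi, AddChar.map_add_eq_mul, ih]

section Weyl

variable {q n : ℕ} {F : Type*} [Field F]

/-- The Weyl operator `X(a) Z(b)`, `(a, b) = v`, up to a phase. -/
noncomputable def weyl (e : Fin q ≃ F) (χ : AddChar F ℂ) (v : Fin n → F × F) :
    QuditSpace q n →ₗ[ℂ] QuditSpace q n where
  toFun ψ := WithLp.toLp 2 fun x =>
    χ (∑ i, (v i).2 * e (x i)) * ψ fun i => e.symm (e (x i) - (v i).1)
  map_add' ψ ψ' := by ext x; simp [mul_add]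
  map_smul' c ψ := by ext x; simp; ring

lemma weyl_apply (e : Fin q ≃ F) (χ : AddChar F ℂ) (v : Fin n → F × F) (ψ : QuditSpace q n)
    (x : Fin n → Fin q) : weyl e χ v ψ x =
      χ (∑ i, (v i).2 * e (x i)) * ψ fun i => e.symm (e (x i) - (v i).1) := rfl

lemma weyl_zero (e : Fin q ≃ F) (χ : AddChar F ℂ) : weyl (n := n) e χ 0 = LinearMap.id := by
  ext ψ x
  simp [weyl_apply]

lemma weyl_weyl (e : Fin q ≃ F) (χ : AddChar F ℂ) (u v : Fin n → F × F) (ψ : QuditSpace q n) :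
    weyl e χ u (weyl e χ v ψ) = χ (-∑ i, (u i).1 * (v i).2) • weyl e χ (u + v) ψ := by
  ext x
  simp only [weyl_apply, PiLp.smul_apply, smul_eq_mul, Equiv.apply_symm_apply]
  rw [← mul_assoc, ← mul_assoc, ← AddChar.map_add_eq_mul, ← AddChar.map_add_eq_mul]
  refine congrArg₂ (· * ·) (congrArg χ ?_) (congrArg ψ.ofLp ?_)
  · rw [← Finset.sum_neg_distrib, ← Finset.sum_add_distrib, ← Finset.sum_add_distrib]
    refine Finset.sum_congr rfl fun i _ => ?_
    simp only [Pi.add_apply, Prod.snd_add]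
    ring
  · funext i
    simp [sub_sub]

/-- Both products are phases times the Weyl operator of `u + v`; the phases differ by the symplectic
form. Hence isotropic spaces give commuting operators, and translating an eigenvector multiplies its
eigenvalues by characters. -/
lemma weyl_comm (e : Fin q ≃ F) (χ : AddChar F ℂ) (u v : Fin n → F × F) (ψ : QuditSpace q n) :
    weyl e χ u (weyl e χ v ψ) =
      χ (-symplecticForm F n u v) • weyl e χ v (weyl e χ u ψ) := by
  rw [weyl_weyl, weyl_weyl, smul_smul, ← AddChar.map_add_eq_mul, add_comm v u]
  congr 2
  rw [symplecticForm_apply, ← Finset.sum_neg_distrib, ← Finset.sum_neg_distrib,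
    ← Finset.sum_neg_distrib, ← Finset.sum_add_distrib]
  exact Finset.sum_congr rfl fun i _ => by ring

lemma inner_weyl_weyl [Finite F] (e : Fin q ≃ F) (χ : AddChar F ℂ) (v : Fin n → F × F)
    (a b : QuditSpace q n) : inner ℂ (weyl e χ v a) (weyl e χ v b) = inner ℂ a b := by
  simp only [PiLp.inner_apply, weyl_apply]
  let τ : (Fin n → Fin q) ≃ (Fin n → Fin q) :=
    Equiv.piCongrRight fun i => (e.trans (Equiv.subRight (v i).1)).trans e.symm
  conv_rhs => rw [← Equiv.sum_comp τ]
  refine Finset.sum_congr rfl fun x _ => ?_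
  have hχ : χ (∑ i, (v i).2 * e (x i)) * (starRingEnd ℂ) (χ (∑ i, (v i).2 * e (x i))) = 1 := by
    rw [Complex.mul_conj, Complex.normSq_eq_norm_sq, AddChar.norm_apply]
    simp
  have hτ : τ x = fun i => e.symm (e (x i) - (v i).1) := rfl
  rw [hτ]
  simp only [RCLike.inner_apply, map_mul]
  linear_combination (b _ * (starRingEnd ℂ) (a _)) * hχ

lemma weyl_apply_ne_zero [Finite F] (e : Fin q ≃ F) (χ : AddChar F ℂ) (v : Fin n → F × F)
    {ψ : QuditSpace q n} (hψ : ψ ≠ 0) : weyl e χ v ψ ≠ 0 := by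
  intro h
  have := inner_weyl_weyl e χ v ψ ψ
  rw [h, inner_zero_left] at this
  exact hψ (inner_self_eq_zero.mp this.symm)

lemma affectsOnly_weyl (e : Fin q ≃ F) (χ : AddChar F ℂ) (T : Finset (Fin n))
    (v : Fin n → F × F) (hv : ∀ i ∉ T, v i = 0) : AffectsOnly T (weyl e χ v) := by
  classical
  refine ⟨fun x u => if u = (fun i : T => e.symm (e (x i) - (v i).1)) then
    χ (∑ i : T, (v i).2 * e (x i)) else 0, fun ψ x => ?_⟩
  simp only [ite_mul, zero_mul, Finset.sum_ite_eq', Finset.mem_univ, if_true]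
  rw [weyl_apply]
  refine congrArg₂ (· * ·) (congrArg χ ?_) (congrArg ψ.ofLp ?_)
  · rw [Finset.sum_coe_sort T (fun i => (v i).2 * e (x i))]
    refine (Finset.sum_subset (Finset.subset_univ T) fun i _ hi => ?_).symm
    simp [hv i hi]
  · funext i
    by_cases hi : i ∈ T
    · simp [overwrite, hi]
    · simp [overwrite, hi, hv i hi]

/-- Extension of a family on `T` by zero. -/
def extendZero {T : Finset (Fin n)} (w : T → F × F) (i : Fin n) : F × F :=
  if h : i ∈ T then w ⟨i, h⟩ else 0

/-- Local operators are combinations of local Weyl operators. -/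
lemma mem_span_weyl_of_affectsOnly [Fintype F] (e : Fin q ≃ F) {χ : AddChar F ℂ} (hχ : χ.IsPrimitive)
    (T : Finset (Fin n)) (E : QuditSpace q n →ₗ[ℂ] QuditSpace q n) (hE : AffectsOnly T E) :
    E ∈ Submodule.span ℂ (weyl e χ '' {v | ∀ i ∉ T, v i = 0}) := by
  classical
  obtain ⟨M, hM⟩ := hE
  have hortho : ∀ y : T → F, ∑ b : T → F, χ (∑ i, b i * y i) =
      if y = 0 then (Fintype.card F : ℂ) ^ T.card else 0 := by
    intro y
    have h1 : ∀ b : T → F, χ (∑ i, b i * y i) = ∏ i, χ (b i * y i) := fun b =>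
      χ.map_sum_eq_prod_apply _ _
    simp_rw [h1]
    rw [← Fintype.prod_sum (fun i (c : F) => χ (c * y i))]
    simp_rw [AddChar.sum_mulShift _ hχ]
    split_ifs with hy
    · subst hy; simp
    · obtain ⟨i, hi⟩ := Function.ne_iff.mp hy
      exact Finset.prod_eq_zero (Finset.mem_univ i) (by simpa using hi)
  let N : ℂ := (Fintype.card F : ℂ) ^ T.card
  have hN : N ≠ 0 := pow_ne_zero _ (Nat.cast_ne_zero.mpr Fintype.card_ne_zero)
  -- Fourier inversion: for each shift `a`, the entries of `M` at (y, y - a), as a function of y,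
  -- are expanded in the characters y ↦ χ(b · y).
  have hE : E = ∑ a : T → F, ∑ b : T → F, (N⁻¹ * ∑ y : T → Fin q,
      χ (-∑ i, b i * e (y i)) * M y (fun i => e.symm (e (y i) - a i))) •
        weyl e χ (extendZero fun i => (a i, b i)) := by
    ext ψ x
    rw [hM]
    simp only [LinearMap.sum_apply, LinearMap.smul_apply]
    rw [WithLp.ofLp_sum, Finset.sum_apply]
    let σ : (T → F) ≃ (T → Fin q) :=
      Equiv.piCongrRight fun i => (Equiv.subLeft (e (x i))).trans e.symm
    rw [← Equiv.sum_comp σ]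
    refine Finset.sum_congr rfl fun a _ => ?_
    rw [WithLp.ofLp_sum, Finset.sum_apply]
    have hσ : σ a = fun i : T => e.symm (e (x i) - a i) := rfl
    have harg : ∀ b : T → F, (fun i => e.symm (e (x i) -
        (extendZero (fun i : T => (a i, b i)) i).1)) = overwrite T (σ a) x := by
      intro b
      funext i
      by_cases hi : i ∈ T
      · simp [overwrite, extendZero, hi, hσ]
      · simp [overwrite, extendZero, hi]
    have hphase : ∀ b : T → F, ∑ i, (extendZero (fun i : T => (a i, b i)) i).2 * e (x i) =
        ∑ i : T, b i * e (x i) := by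
      intro b
      rw [← Finset.sum_subset (Finset.subset_univ T), ← Finset.sum_coe_sort T]
      · refine Finset.sum_congr rfl fun i _ => ?_
        simp [extendZero]
      · intro i _ hi
        simp [extendZero, hi]
    simp only [PiLp.smul_apply, weyl_apply, harg, hphase, smul_eq_mul]
    simp_rw [← mul_assoc]
    rw [← Finset.sum_mul]
    congr 1
    simp_rw [mul_assoc, ← Finset.mul_sum, Finset.sum_mul]
    rw [Finset.sum_comm]
    have hinner : ∀ y : T → Fin q, ∑ b : T → F, χ (-∑ i, b i * e (y i)) *
        M y (fun i => e.symm (e (y i) - a i)) * χ (∑ i : T, b i * e (x i)) =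
        if y = (fun i : T => x i) then N * M (fun i => x i) (σ a) else 0 := by
      intro y
      have : ∀ b : T → F, χ (-∑ i, b i * e (y i)) *
        M y (fun i => e.symm (e (y i) - a i)) * χ (∑ i : T, b i * e (x i)) =
          χ (∑ i, b i * (e (x i) - e (y i))) * M y (fun i => e.symm (e (y i) - a i)) := by
        intro b
        rw [mul_right_comm, ← AddChar.map_add_eq_mul]
        congr 2
        rw [← Finset.sum_neg_distrib, ← Finset.sum_add_distrib]
        exact Finset.sum_congr rfl fun i _ => by ring
      simp_rw [this]
      rw [← Finset.sum_mul, hortho (fun i : T => e (x i) - e (y i))]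
      by_cases hy : y = fun i : T => x i
      · subst hy
        simp [N, hσ, Pi.zero_def]
      · rw [if_neg hy, if_neg, zero_mul]
        intro h
        refine hy (funext fun i => ?_)
        have := congrFun h i
        exact (e.injective (sub_eq_zero.mp this)).symm
    simp_rw [hinner]
    simp [hN]
  rw [hE]
  refine Submodule.sum_mem _ fun a _ => Submodule.sum_mem _ fun b _ =>
    Submodule.smul_mem _ _ (Submodule.subset_span ⟨_, fun i hi => ?_, rfl⟩)
  simp [extendZero, hi]

end Weyl

/-! ### Subsystem codes given by orthonormal families, and criteria for detectability. -/

namespace SubsystemCode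

variable {q n K R : ℕ}

/-- An orthonormal family as an orthonormal basis of its span. -/
noncomputable def spanBasis {ι : Type*} [Fintype ι] (b : ι → QuditSpace q n)
    (hb : Orthonormal ℂ b) : OrthonormalBasis ι ℂ (Submodule.span ℂ (Set.range b)) :=
  (Module.Basis.span hb.linearIndependent).toOrthonormalBasis (by
    rw [← (Submodule.span ℂ (Set.range b)).subtypeₗᵢ.orthonormal_comp_iff]
    convert hb using 1
    funext i
    simp [Module.Basis.span_apply])

lemma coe_spanBasis {ι : Type*} [Fintype ι] (b : ι → QuditSpace q n) (hb : Orthonormal ℂ b)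
    (i : ι) : (spanBasis b hb i : QuditSpace q n) = b i := by
  simp [spanBasis, Module.Basis.span_apply]

/-- The subsystem code with the orthonormal basis `b (i, j) = i ⊗ j`. -/
noncomputable def ofOrthonormal (b : Fin K × Fin R → QuditSpace q n) (hb : Orthonormal ℂ b) :
    SubsystemCode q n K R where
  space := Submodule.span ℂ (Set.range b)
  split := ((EuclideanSpace.basisFun (Fin K) ℂ).tensorProduct
    (EuclideanSpace.basisFun (Fin R) ℂ)).equiv (spanBasis b hb) (Equiv.refl _)

section

variable (b : Fin K × Fin R → QuditSpace q n) (hb : Orthonormal ℂ b)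

lemma ofOrthonormal_split_basis (i : Fin K) (j : Fin R) :
    (((ofOrthonormal b hb).split (EuclideanSpace.basisFun (Fin K) ℂ i ⊗ₜ[ℂ]
      EuclideanSpace.basisFun (Fin R) ℂ j) : (ofOrthonormal b hb).space) : QuditSpace q n) =
      b (i, j) := by
  rw [← OrthonormalBasis.tensorProduct_apply]
  have h := ((EuclideanSpace.basisFun (Fin K) ℂ).tensorProduct
    (EuclideanSpace.basisFun (Fin R) ℂ)).equiv_apply_basis (spanBasis b hb) (Equiv.refl _) (i, j)
  exact (congrArg Subtype.val h).trans (coe_spanBasis b hb (i, j))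

lemma ofOrthonormal_mem (z : Fin K × Fin R) : b z ∈ (ofOrthonormal b hb).space :=
  Submodule.subset_span ⟨z, rfl⟩

end

/-- The operator `G` can be chosen linearly in `E`; this reduces detection of local errors to local
Weyl operators. -/
lemma detects_of_mem_span (Q : SubsystemCode q n K R)
    {S : Set (QuditSpace q n →ₗ[ℂ] QuditSpace q n)} (hS : ∀ E ∈ S, Q.Detects E)
    {E : QuditSpace q n →ₗ[ℂ] QuditSpace q n} (hE : E ∈ Submodule.span ℂ S) : Q.Detects E := by
  induction hE using Submodule.span_induction with
  | mem E hE => exact hS E hE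
  | zero => exact ⟨0, fun t => by simp⟩
  | add E E' _ _ h h' =>
    obtain ⟨G, hG⟩ := h
    obtain ⟨G', hG'⟩ := h'
    exact ⟨G + G', fun t => by simp [TensorProduct.map_add_right, hG, hG']⟩
  | smul c E _ h =>
    obtain ⟨G, hG⟩ := h
    exact ⟨c • G, fun t => by simp [TensorProduct.map_smul_right, hG]⟩

lemma detects_id (Q : SubsystemCode q n K R) : Q.Detects LinearMap.id :=
  ⟨LinearMap.id, fun t => by simp⟩

lemma detects_of_inner_eq_zero (Q : SubsystemCode q n K R)
    {E : QuditSpace q n →ₗ[ℂ] QuditSpace q n}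
    (h : ∀ a ∈ Q.space, ∀ c ∈ Q.space, inner ℂ a (E c) = 0) : Q.Detects E := by
  refine ⟨0, fun t => ?_⟩
  rw [Submodule.orthogonalProjectionOnto_eq_zero_iff.mpr fun a ha => h a ha _ (Q.split t).2]
  simp

/-- On the code space, a detectable operator that preserves it commutes with every operator that
acts on the information subsystem by a diagonal matrix. -/
lemma comm_of_detects (b : Fin K × Fin R → QuditSpace q n) (hb : Orthonormal ℂ b)
    {E W : QuditSpace q n →ₗ[ℂ] QuditSpace q n} (hdet : (ofOrthonormal b hb).Detects E)
    (hE : ∀ a ∈ (ofOrthonormal b hb).space, E a ∈ (ofOrthonormal b hb).space) (c : Fin K → ℂ)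
    (hW : ∀ i j, W (b (i, j)) = c i • b (i, j)) (i : Fin K) (j : Fin R) :
    W (E (b (i, j))) = E (W (b (i, j))) := by
  obtain ⟨G, hG⟩ := hdet
  -- `E` preserves the code, so the projection is harmless and `E` sends i ⊗ j to i ⊗ G j, on which
  -- `W` still acts by `c i`.
  have h1 : E (b (i, j)) = ((ofOrthonormal b hb).split (EuclideanSpace.basisFun (Fin K) ℂ i ⊗ₜ[ℂ]
      G (EuclideanSpace.basisFun (Fin R) ℂ j)) : (ofOrthonormal b hb).space) := by
    have := hG (EuclideanSpace.basisFun (Fin K) ℂ i ⊗ₜ[ℂ] EuclideanSpace.basisFun (Fin R) ℂ j)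
    rw [ofOrthonormal_split_basis, TensorProduct.map_tmul, LinearMap.id_apply] at this
    rw [← this]
    exact (Submodule.orthogonalProjectionOnto_mem_subspace_eq_self
      (K := (ofOrthonormal b hb).space) ⟨_, hE _ (ofOrthonormal_mem b hb (i, j))⟩ ▸ rfl)
  rw [hW, map_smul, h1]
  generalize G (EuclideanSpace.basisFun (Fin R) ℂ j) = y
  rw [← (EuclideanSpace.basisFun (Fin R) ℂ).sum_repr y, TensorProduct.tmul_sum]
  simp only [map_sum, TensorProduct.tmul_smul, map_smul, Submodule.coe_sum, Submodule.coe_smul,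
    ofOrthonormal_split_basis, hW, Finset.smul_sum]
  exact Finset.sum_congr rfl fun k _ => smul_comm _ _ _

end SubsystemCode

/-! ### From isotropic subspaces to subsystem codes. -/

section MinDist

variable {q n κ r δ : ℕ} {F : Type*} [Field F]

lemma eq_zero_of_forall_addChar_mul {χ : AddChar F ℂ} (hχ : χ ≠ 1) {a : F}
    (h : ∀ c, χ (c * a) = 1) : a = 0 := by
  by_contra ha
  obtain ⟨b, hb⟩ := AddChar.ne_one_iff.mp hχ
  exact hb (by simpa [ha] using h (b * a⁻¹))

/-- Closure of `S` under scalars upgrades triviality of one nontrivial character to vanishing of the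
form itself. -/
lemma mem_orthogonal_of_forall_addChar {χ : AddChar F ℂ} (hχ : χ ≠ 1)
    {S : Submodule F (Fin n → F × F)} {v : Fin n → F × F}
    (h : ∀ l ∈ S, χ (-symplecticForm F n l v) = 1) : v ∈ (symplecticForm F n).orthogonal S := by
  intro l hl
  refine eq_zero_of_forall_addChar_mul hχ fun c => ?_
  have := h (-c • l) (S.smul_mem _ hl)
  rw [map_smul, LinearMap.smul_apply, smul_eq_mul, neg_mul, neg_neg] at this
  exact this

/-- If the dual of `D` meets the Singleton bound, its words of minimum weight span it. -/
lemma symplecticForm_eq_zero_of_minWeight (D : Submodule F (Fin n → F × F))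
    (hδ : Module.finrank F D + 2 = 2 * δ) (hn : δ ≤ n)
    (hdist : ∀ v ∈ (symplecticForm F n).orthogonal D, ∀ T : Finset (Fin n), T.card < δ →
      (∀ i ∉ T, v i = 0) → v = 0) (w : Fin n → F × F)
    (hw : ∀ v ∈ (symplecticForm F n).orthogonal D, ∀ T : Finset (Fin n), T.card = δ →
      (∀ i ∉ T, v i = 0) → symplecticForm F n w v = 0) :
    ∀ v ∈ (symplecticForm F n).orthogonal D, symplecticForm F n w v = 0 := by
  classical
  obtain ⟨T, -, hT⟩ := Finset.exists_subset_card_eq (s := (Finset.univ : Finset (Fin n)))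
    (n := δ - 1) (by rw [Finset.card_univ, Fintype.card_fin]; omega)
  let ρ : (symplecticForm F n).orthogonal D →ₗ[F] ({i // i ∉ T} → F × F) :=
    LinearMap.funLeft F (F × F) (fun i : {i // i ∉ T} => (i : Fin n)) ∘ₗ Submodule.subtype _
  have hρ : ∀ v i, ρ v i = (v : Fin n → F × F) i := fun v i => rfl
  have hinj : Function.Injective ρ := by
    rw [← LinearMap.ker_eq_bot, LinearMap.ker_eq_bot']
    intro v hv
    exact Subtype.ext (hdist v v.2 T (by omega) fun i hi => by rw [← hρ v ⟨i, hi⟩, hv]; rfl)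
  -- Forgetting δ - 1 positions is injective by the distance, hence bijective because dim D^⊥ = 2(n
  -- - δ + 1). The preimage of a word supported at one position i is supported on T ∪ {i}, which has
  -- δ elements; these preimages span.
  have hsurj : Function.Surjective ρ := by
    rw [← LinearMap.injective_iff_surjective_of_finrank_eq_finrank]
    · exact hinj
    · rw [LinearMap.BilinForm.finrank_orthogonal symplecticForm_nondegenerate, finrank_prod_pi,
        finrank_prod_pi, Fintype.card_subtype_compl, Fintype.card_fin, Fintype.card_coe]
      omega
  intro v hv
  choose p hp using fun i : {i // i ∉ T} => hsurj (Pi.single i (v i))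
  have hsum : ∑ i, p i = ⟨v, hv⟩ := by
    apply hinj
    rw [map_sum]
    simp_rw [hp]
    exact Finset.univ_sum_single (fun i : {i // i ∉ T} => v i)
  have hv' : v = ∑ i, (p i : Fin n → F × F) := by
    rw [← Submodule.coe_sum, hsum]
  rw [hv', map_sum]
  refine Finset.sum_eq_zero fun i _ => hw _ (p i).2 (insert (i : Fin n) T) ?_ fun k hk => ?_
  · rw [Finset.card_insert_of_notMem i.2]
    omega
  · rw [Finset.mem_insert, not_or] at hk
    rw [← hρ (p i) ⟨k, hk.2⟩, hp, Pi.single_eq_of_ne]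
    exact fun h => hk.1 (congrArg Subtype.val h)

/-- A self-orthogonal symplectic code whose dual meets the Singleton bound gives subsystem codes,
in which the dimensions of the two subsystems can be traded against each other. -/
theorem exists_subsystemCode_of_isotropic [Fintype F] (hq : Fintype.card F = q)
    (D : Submodule F (Fin n → F × F)) (hD : D ≤ (symplecticForm F n).orthogonal D)
    (hdim : Module.finrank F D + κ + r = n) (hδ : Module.finrank F D + 2 = 2 * δ) (hκ : 0 < κ)
    (hdist : ∀ v ∈ (symplecticForm F n).orthogonal D, ∀ T : Finset (Fin n), T.card < δ →
      (∀ i ∉ T, v i = 0) → v = 0) :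
    ∃ Q : SubsystemCode q n (q ^ κ) (q ^ r), Q.HasMinDist δ := by
  classical
  obtain ⟨χ, hχ⟩ : ∃ χ : AddChar F ℂ, χ ≠ 1 := by
    obtain ⟨χ, hχ⟩ := (AddChar.exists_apply_ne_zero (a := (1 : F))).mpr one_ne_zero
    exact ⟨χ, fun h => hχ (by rw [h]; rfl)⟩
  have hχ0 : ∀ a, χ a ≠ 0 := fun a h => by
    have := AddChar.norm_apply χ a
    simp [h] at this
  let e : Fin q ≃ F := (Fintype.equivFinOfCardEq hq).symm
  let eκ : Fin (q ^ κ) ≃ (Fin κ → F) := (Fintype.equivFinOfCardEq (by simp [hq])).symm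
  let er : Fin (q ^ r) ≃ (Fin r → F) := (Fintype.equivFinOfCardEq (by simp [hq])).symm
  obtain ⟨L, g, f, hDL, hL, hgs, hgD, hf, hDf⟩ := exists_logical_frame (κ := κ) (r := r) D hD hdim
  have : Nonempty (Fin q) := ⟨e.symm 0⟩
  obtain ⟨φ, hφ, c, hc⟩ : ∃ φ : QuditSpace q n, ‖φ‖ = 1 ∧ ∃ c : (Fin n → F × F) → ℂ,
      ∀ l ∈ L, weyl e χ l φ = c l • φ := by
    obtain ⟨φ, hφ, c, hc⟩ := exists_common_eigenvector
      (fun l : L => (weyl e χ (l : Fin n → F × F) : Module.End ℂ (QuditSpace q n))) (by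
        intro l m
        refine LinearMap.ext fun ψ => ?_
        have h0 : symplecticForm F n l m = 0 := (hL.ge m.2) l l.2
        rw [Module.End.mul_apply, Module.End.mul_apply, weyl_comm, h0]
        simp)
    -- Off `L` the eigenvalue function is given the default value 0; only its values on `L` matter.
    refine ⟨((‖φ‖⁻¹ : ℝ) : ℂ) • φ, ?_, fun l => if h : l ∈ L then c ⟨l, h⟩ else 0, fun l hl => ?_⟩
    · rw [norm_smul]
      simp [hφ]
    · simp only [hl, dite_true]
      rw [map_smul, hc ⟨l, hl⟩, smul_comm]
  have hφ0 : φ ≠ 0 := fun h => by simp [h] at hφ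
  have hc0 : ∀ l ∈ L, c l ≠ 0 := fun l hl h => by
    have := hc l hl
    rw [h, zero_smul] at this
    exact weyl_apply_ne_zero e χ l hφ0 this
  let B : (Fin κ → F) × (Fin r → F) → QuditSpace q n := fun z => weyl e χ (f z) φ
  have hB : ∀ l ∈ L, ∀ z, weyl e χ l (B z) = (χ (-symplecticForm F n l (f z)) * c l) • B z := by
    intro l hl z
    simp only [B]
    rw [weyl_comm, hc l hl, map_smul, smul_smul]
  have hfD : ∀ z, f z ∈ (symplecticForm F n).orthogonal D := by
    intro z d hd
    change symplecticForm F n d (f z) = 0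
    rw [hf, hgD d hd]
    simp
  have hfL : ∀ z, f z ∈ (symplecticForm F n).orthogonal L → z = 0 := by
    intro z hz
    have h0 : ∀ w : (Fin κ → F) × (Fin r → F), w.1 ⬝ᵥ z.1 + w.2 ⬝ᵥ z.2 = 0 := by
      intro w
      obtain ⟨l, hl, rfl⟩ := hgs w
      rw [← hf]
      exact hz l hl
    refine Prod.ext ?_ ?_
    · exact dotProduct_eq_zero _ fun w => by simpa [dotProduct_comm] using h0 (w, 0)
    · exact dotProduct_eq_zero _ fun w => by simpa [dotProduct_comm] using h0 (0, w)
  have hBorth : ∀ z z', z ≠ z' → inner ℂ (B z) (B z') = 0 := by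
    intro z z' hzz
    -- Distinct labels give distinct characters of `L`, so some Weyl operator from `L` separates the
    -- two vectors by eigenvalue.
    obtain ⟨l, hl, hne⟩ : ∃ l ∈ L, χ (-symplecticForm F n l (f (z - z'))) ≠ 1 := by
      by_contra! h
      exact sub_ne_zero.mpr hzz (hfL _ (mem_orthogonal_of_forall_addChar hχ h))
    refine inner_eq_zero_of_isometry_eigenvalue_ne (weyl e χ l) (inner_weyl_weyl e χ l)
      (hB l hl z) (hB l hl z') fun h => hne ?_
    have h := mul_right_cancel₀ (hc0 l hl) h
    rw [map_sub, map_sub, neg_sub, sub_eq_neg_add, AddChar.map_add_eq_mul, h,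
      ← AddChar.map_add_eq_mul, neg_add_cancel, AddChar.map_zero_eq_one]
  let b : Fin (q ^ κ) × Fin (q ^ r) → QuditSpace q n := fun z => B (eκ z.1, er z.2)
  have hb : Orthonormal ℂ b := by
    refine ⟨fun z => ?_, fun z z' hzz => hBorth _ _ fun h => hzz ?_⟩
    · exact (((weyl e χ (f (eκ z.1, er z.2))).isometryOfInner
        (inner_weyl_weyl e χ _)).norm_map φ).trans hφ
    · exact Prod.ext (eκ.injective (congrArg Prod.fst h)) (er.injective (congrArg Prod.snd h))
  let Q := SubsystemCode.ofOrthonormal b hb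
  have hBQ : ∀ z, B z ∈ Q.space := by
    intro z
    have := SubsystemCode.ofOrthonormal_mem b hb (eκ.symm z.1, er.symm z.2)
    simpa [b] using this
  have hDQ : ∀ d ∈ D, ∀ a ∈ Q.space, weyl e χ d a = c d • a := by
    intro d hd a ha
    induction ha using Submodule.span_induction with
    | mem a ha =>
      obtain ⟨z, rfl⟩ := ha
      have h0 : symplecticForm F n d (f (eκ z.1, er z.2)) = 0 := hfD _ d hd
      have := hB d (hDL hd) (eκ z.1, er z.2)
      rw [h0] at this
      simpa using this
    | zero => simp
    | add a a' _ _ h h' => rw [map_add, h, h', smul_add]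
    | smul t a _ h => rw [map_smul, h, smul_comm]
  have hstab : ∀ v ∈ (symplecticForm F n).orthogonal D, ∀ a ∈ Q.space,
      weyl e χ v a ∈ Q.space := by
    intro v hv a ha
    induction ha using Submodule.span_induction with
    | mem a ha =>
      obtain ⟨z, rfl⟩ := ha
      obtain ⟨z', l, hl, rfl⟩ := hDf v hv
      change weyl e χ (f z' + l) (weyl e χ (f (eκ z.1, er z.2)) φ) ∈ Q.space
      rw [weyl_weyl]
      refine Q.space.smul_mem _ ?_
      -- The `L`-component acts on `φ` by a scalar, so up to nonzero scalars the result is the basis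
      -- vector with label shifted by `z'`.
      have h1 := weyl_weyl e χ (f (z' + (eκ z.1, er z.2))) l φ
      rw [hc l hl, map_smul] at h1
      rw [show f z' + l + f (eκ z.1, er z.2) = f (z' + (eκ z.1, er z.2)) + l by
        rw [map_add]; abel]
      rw [← Submodule.smul_mem_iff _ (hχ0 _), ← h1]
      exact Q.space.smul_mem _ (hBQ _)
    | zero => simp
    | add a a' _ _ h h' => rw [map_add]; exact Q.space.add_mem h h'
    | smul t a _ h => rw [map_smul]; exact Q.space.smul_mem _ h
  refine ⟨Q, fun T E hT hE => ?_, ?_⟩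
  · refine Q.detects_of_mem_span ?_
      (mem_span_weyl_of_affectsOnly e (AddChar.IsPrimitive.of_ne_one hχ) T E hE)
    rintro _ ⟨v, hv, rfl⟩
    by_cases hvD : v ∈ (symplecticForm F n).orthogonal D
    · rw [hdist v hvD T hT hv, weyl_zero]
      exact Q.detects_id
    · obtain ⟨d, hd, hne⟩ : ∃ d ∈ D, χ (-symplecticForm F n d v) ≠ 1 := by
        by_contra! h
        exact hvD (mem_orthogonal_of_forall_addChar hχ h)
      -- An error outside D^⊥ changes the eigenvalue of some Weyl operator from `D`, hence moves the
      -- code into its orthogonal complement.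
      refine Q.detects_of_inner_eq_zero fun a ha a' ha' => ?_
      have h1 : weyl e χ d (weyl e χ v a') =
          (χ (-symplecticForm F n d v) * c d) • weyl e χ v a' := by
        rw [weyl_comm, hDQ d hd a' ha', map_smul, smul_smul]
      refine inner_eq_zero_of_isometry_eigenvalue_ne (weyl e χ d) (inner_weyl_weyl e χ d)
        (hDQ d hd a ha) h1 fun h => hne ?_
      exact (mul_right_cancel₀ (hc0 d (hDL hd)) ((one_mul _).trans h)).symm
  · by_contra! hdet
    -- The Weyl operator of `w` reads off the first digit of the `A`-label, so it is diagonal on A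
    -- and trivial on B up to a scalar. If all errors on δ qudits were detectable, `w` would be
    -- orthogonal to every weight-δ word of D^⊥, hence to D^⊥, although it pairs to 1 with one of
    -- its vectors. Here κ > 0 is needed.
    obtain ⟨w, hwL, hgw⟩ := hgs (Pi.single ⟨0, hκ⟩ 1, 0)
    have hwf : ∀ x y, symplecticForm F n w (f (x, y)) = x ⟨0, hκ⟩ := by
      intro x y
      rw [hf, hgw]
      simp
    have hperp := symplecticForm_eq_zero_of_minWeight D hδ (by omega) hdist w (by
      intro v hv T hT hvT
      -- Commutation only gives a phase equal to 1; using all multiples of `v` turns this into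
      -- vanishing of the form.
      refine eq_zero_of_forall_addChar_mul hχ fun t => ?_
      have hv' : (-t) • v ∈ (symplecticForm F n).orthogonal D := Submodule.smul_mem _ _ hv
      have hd := hdet T (weyl e χ ((-t) • v)) hT
        (affectsOnly_weyl e χ T _ fun i hi => by rw [Pi.smul_apply, hvT i hi, smul_zero])
      have hcomm := SubsystemCode.comm_of_detects b hb (W := weyl e χ w) hd (hstab _ hv')
        (fun i => χ (-(eκ i ⟨0, hκ⟩)) * c w) (fun i j => by
          have := hB w hwL (eκ i, er j)
          rw [hwf] at this
          exact this) (eκ.symm 0) (er.symm 0)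
      have hb0 : b (eκ.symm 0, er.symm 0) ≠ 0 := hb.ne_zero _
      rw [weyl_comm, map_smul, smul_eq_mul, neg_mul, neg_neg] at hcomm
      have hne := weyl_apply_ne_zero e χ ((-t) • v) (weyl_apply_ne_zero e χ w hb0)
      exact smul_left_injective ℂ hne (hcomm.trans (one_smul _ _).symm))
    have := hperp _ (hfD (Pi.single ⟨0, hκ⟩ 1, 0))
    rw [hwf] at this
    simp at this

end MinDist

/-! ### Hermitian self-orthogonal generalized Reed-Solomon codes. -/

section GRS

open Polynomial

variable {F K : Type*} [Field F] [Fintype F] [Field K] [Fintype K] [Algebra F K]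

/-- The norm of a quadratic extension of finite fields is `x * x ^ q`. -/
lemma algebraMap_norm_of_finrank_eq_two (h2 : Module.finrank F K = 2) (x : K) :
    algebraMap F K (Algebra.norm F x) = x * FiniteField.frobeniusAlgHom F K x := by
  have hF : 1 < Nat.card F := Finite.one_lt_card
  have hdiv : (Nat.card K - 1) / (Nat.card F - 1) = Nat.card F + 1 := by
    rw [Module.natCard_eq_pow_finrank (K := F) (V := K), h2]
    refine Nat.div_eq_of_eq_mul_left (by omega) ?_
    have := Nat.sq_sub_sq (Nat.card F) 1
    simpa using this
  rw [FiniteField.algebraMap_norm_eq_pow, hdiv, pow_succ', FiniteField.frobeniusAlgHom_apply,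
    Nat.card_eq_fintype_card]

/-- Fixed points are roots of X^q - X, of which there are at most q < q². -/
lemma exists_frobeniusAlgHom_ne (h2 : Module.finrank F K = 2) :
    ∃ θ : K, FiniteField.frobeniusAlgHom F K θ ≠ θ := by
  by_contra! h
  have hF : 1 < Fintype.card F := Fintype.one_lt_card
  have h1 := Polynomial.card_le_degree_of_subset_roots (p := X ^ Fintype.card F - X)
    (Z := (Finset.univ : Finset K)) (by
      intro x _
      rw [mem_roots (FiniteField.X_pow_card_sub_X_ne_zero K hF)]
      have := h x
      rw [FiniteField.frobeniusAlgHom_apply] at this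
      simp [this])
  rw [FiniteField.X_pow_card_sub_X_natDegree_eq K hF, Finset.card_univ,
    Module.card_eq_pow_finrank (K := F) (V := K), h2] at h1
  nlinarith

/-- A basis of a quadratic extension in which `x * x'ᵠ - xᵠ * x'` is a multiple of the
determinant. -/
lemma exists_symplectic_coordinates (h2 : Module.finrank F K = 2) :
    ∃ (τ : (F × F) ≃ₗ[F] K) (γ : K), γ ≠ 0 ∧ ∀ a b : F × F,
      τ a * FiniteField.frobeniusAlgHom F K (τ b) - FiniteField.frobeniusAlgHom F K (τ a) * τ b =
        algebraMap F K (a.1 * b.2 - a.2 * b.1) * γ := by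
  obtain ⟨θ, hθ⟩ := exists_frobeniusAlgHom_ne (F := F) (K := K) h2
  -- The basis is 1, θ with θ^q ≠ θ, and γ = θ^q - θ.
  let τ₀ : (F × F) →ₗ[F] K :=
    (Algebra.linearMap F K).coprod ((LinearMap.mulRight F θ) ∘ₗ Algebra.linearMap F K)
  have hτ₀ : ∀ a, τ₀ a = algebraMap F K a.1 + algebraMap F K a.2 * θ := fun a => rfl
  have hinj : Function.Injective τ₀ := by
    rw [← LinearMap.ker_eq_bot, LinearMap.ker_eq_bot']
    rintro ⟨a, b⟩ h
    rw [hτ₀] at h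
    have hb : b = 0 := by
      by_contra hb
      have hb' : algebraMap F K b ≠ 0 := by simpa using hb
      have : θ = algebraMap F K (-a / b) := by
        rw [map_div₀, map_neg, eq_div_iff hb']
        linear_combination h
      exact hθ (by rw [this, AlgHom.commutes])
    subst hb
    simpa using h
  refine ⟨LinearEquiv.ofInjectiveOfFinrankEq τ₀ hinj (by simp [h2]),
    FiniteField.frobeniusAlgHom F K θ - θ, sub_ne_zero.mpr hθ, fun a b => ?_⟩
  have hτ : ∀ a, LinearEquiv.ofInjectiveOfFinrankEq τ₀ hinj (by simp [h2]) a = τ₀ a := fun a => rfl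
  simp only [hτ, hτ₀, map_add, map_mul, AlgHom.commutes, map_sub]
  ring

/-- Hermitian self-orthogonal generalized Reed-Solomon codes give subsystem codes. -/
theorem exists_subsystemCode_of_grs {q n κ r d : ℕ} (hq : Fintype.card F = q)
    (h2 : Module.finrank F K = 2) (x : Fin n → K) (hx : Function.Injective x) (w : Fin n → K)
    (hw : ∀ i, w i ≠ 0) (hn : n = κ + r + 2 * d) (hκ : 0 < κ)
    (horth : ∀ p ∈ degreeLT K d, ∀ p' ∈ degreeLT K d,
      ∑ i, (w i * p.eval (x i)) * FiniteField.frobeniusAlgHom F K (w i * p'.eval (x i)) = 0) :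
    ∃ Q : SubsystemCode q n (q ^ κ) (q ^ r), Q.HasMinDist (d + 1) := by
  classical
  obtain ⟨τ, γ, hγ, hτ⟩ := exists_symplectic_coordinates (F := F) (K := K) h2
  set σ := FiniteField.frobeniusAlgHom F K with hσ
  let ev : degreeLT K d →ₗ[F] (Fin n → F × F) :=
    LinearMap.pi fun i => τ.symm.toLinearMap ∘ₗ LinearMap.mulLeft F (w i) ∘ₗ
      ((leval (x i)).restrictScalars F) ∘ₗ ((degreeLT K d).subtype.restrictScalars F)
  have hev : ∀ p i, τ (ev p i) = w i * (p : K[X]).eval (x i) := fun p i => by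
    simp [ev]
  have hform : ∀ u v : Fin n → F × F, algebraMap F K (symplecticForm F n u v) * γ =
      ∑ i, (τ (u i) * σ (τ (v i)) - σ (τ (u i)) * τ (v i)) := by
    intro u v
    rw [symplecticForm_apply, map_sum, Finset.sum_mul]
    exact Finset.sum_congr rfl fun i _ => (hτ _ _).symm
  have hform0 : ∀ u v : Fin n → F × F, symplecticForm F n u v = 0 ↔
      ∑ i, (τ (u i) * σ (τ (v i)) - σ (τ (u i)) * τ (v i)) = 0 := by
    intro u v
    rw [← hform]
    simp [hγ]
  have hevinj : Function.Injective ev := by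
    rw [← LinearMap.ker_eq_bot, LinearMap.ker_eq_bot']
    intro p hp
    have h0 : ∀ i, (p : K[X]).eval (x i) = 0 := by
      intro i
      have := hev p i
      rw [hp] at this
      simpa [hw i] using this
    apply Subtype.ext
    refine eq_zero_of_degree_lt_of_eval_index_eq_zero (s := Finset.univ) (v := x) hx.injOn ?_
      fun i _ => h0 i
    rw [Finset.card_univ, Fintype.card_fin]
    exact (mem_degreeLT.mp p.2).trans_le (by exact_mod_cast (by omega : d ≤ n))
  have hfin : Module.finrank F (LinearMap.range ev) = 2 * d := by
    rw [LinearMap.finrank_range_of_inj hevinj,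
      ← Module.finrank_mul_finrank F K (degreeLT K d), h2,
      (degreeLTEquiv K d).finrank_eq, Module.finrank_fin_fun]
  refine exists_subsystemCode_of_isotropic hq (LinearMap.range ev) ?_ (by omega) (by omega) hκ ?_
  · rintro _ ⟨p, rfl⟩ _ ⟨p', rfl⟩
    change symplecticForm F n (ev p') (ev p) = 0
    rw [hform0]
    simp only [hev, Finset.sum_sub_distrib]
    rw [horth p' p'.2 p p.2, zero_sub, neg_eq_zero, ← horth p p.2 p' p'.2]
    exact Finset.sum_congr rfl fun i _ => mul_comm _ _
  · intro v hv T hT hvT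
    by_contra hne
    obtain ⟨i, hi⟩ := Function.ne_iff.mp hne
    have hiT : i ∈ T := by
      by_contra h
      exact hi (hvT i h)
    -- `P` vanishes on the support of `v` except at `i`, and its degree |T| - 1 is below `d`.
    -- Pairing `v` with multiples of `P` isolates the coordinate at `i`: c = 1 shows that it is
    -- fixed by Frobenius, and then c = θ shows that it is 0.
    let P : K[X] := ∏ j ∈ T.erase i, (X - C (x j))
    have hPdeg : P.degree < d := by
      rw [degree_prod]
      simp only [degree_X_sub_C, Finset.sum_const, Finset.card_erase_of_mem hiT]
      rw [nsmul_one]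
      have := Finset.card_pos.mpr ⟨i, hiT⟩
      exact_mod_cast (by omega : T.card - 1 < d)
    have hPi : P.eval (x i) ≠ 0 := by
      rw [eval_prod, Finset.prod_ne_zero_iff]
      intro j hj
      rw [eval_sub, eval_X, eval_C, sub_ne_zero]
      exact fun h => (Finset.ne_of_mem_erase hj) (hx h).symm
    have hkey : ∀ c : K, c * σ (τ (v i)) - σ c * τ (v i) = 0 := by
      intro c
      have hmem : C (c * (w i * P.eval (x i))⁻¹) * P ∈ degreeLT K d := by
        rw [← smul_eq_C_mul]
        exact Submodule.smul_mem _ _ (mem_degreeLT.mpr hPdeg)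
      have h := (hform0 _ _).mp (hv (ev ⟨_, hmem⟩) ⟨_, rfl⟩)
      rw [Finset.sum_eq_single i] at h
      · rw [hev, eval_mul, eval_C] at h
        rwa [show w i * (c * (w i * P.eval (x i))⁻¹ * P.eval (x i)) = c by
          field_simp [hw i, hPi]] at h
      · intro j _ hji
        by_cases hj : j ∈ T
        · have : P.eval (x j) = 0 := by
            rw [eval_prod]
            exact Finset.prod_eq_zero (Finset.mem_erase.mpr ⟨hji, hj⟩) (by simp)
          rw [hev, eval_mul, this]
          simp
        · rw [hvT j hj]
          simp
      · simp
    obtain ⟨θ, hθ⟩ := exists_frobeniusAlgHom_ne (F := F) (K := K) h2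
    have h1 := hkey 1
    have hθ' := hkey θ
    rw [map_one, one_mul, one_mul, sub_eq_zero] at h1
    rw [h1, ← sub_mul, mul_eq_zero, or_iff_right (sub_ne_zero.mpr (Ne.symm hθ))] at hθ'
    exact hi (by simpa using hθ')

end GRS

/-! ### Codes from polynomials in the norm. -/

section NormPolynomial

open Polynomial

variable {F K : Type*} [Field F] [Fintype F] [Field K] [Fintype K] [Algebra F K]

/-- Power sums over K vanish for exponents below |K| - 1. -/
lemma sum_eval_eq_zero_of_natDegree_lt (p : K[X]) (hp : p.natDegree < Fintype.card K - 1) :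
    ∑ x, p.eval x = 0 := by
  simp_rw [eval_eq_sum_range]
  rw [Finset.sum_comm]
  refine Finset.sum_eq_zero fun i hi => ?_
  rw [← Finset.mul_sum, FiniteField.sum_pow_lt_card_sub_one, mul_zero]
  rw [Finset.mem_range] at hi
  omega

lemma sum_norm_eval_mul_eq_zero (h2 : Module.finrank F K = 2) (U : F[X]) {d : ℕ}
    (hU : U.natDegree + d + 1 ≤ Fintype.card F) {p p' : K[X]} (hp : p ∈ degreeLT K d)
    (hp' : p' ∈ degreeLT K d) :
    ∑ x : K, algebraMap F K (U.eval (Algebra.norm F x)) *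
      (p.eval x * FiniteField.frobeniusAlgHom F K (p'.eval x)) = 0 := by
  rcases Nat.eq_zero_or_pos d with rfl | hd
  · have : p = 0 := by simpa using mem_degreeLT.mp hp
    simp [this]
  have hdeg : ∀ {p : K[X]}, p ∈ degreeLT K d → p.natDegree ≤ d - 1 := by
    intro p hp
    by_cases h0 : p = 0
    · simp [h0]
    · have := (natDegree_lt_iff_degree_lt h0).mpr (mem_degreeLT.mp hp)
      omega
  have hF : 1 < Fintype.card F := Fintype.one_lt_card
  have hK : Fintype.card K = Fintype.card F ^ 2 := by
    rw [Module.card_eq_pow_finrank (K := F) (V := K), h2]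
  set q := Fintype.card F with hq
  -- `R` replaces the norm by X^(q+1), and p'(x)^q by the conjugate polynomial evaluated at x^q.
  let R : K[X] := (U.map (algebraMap F K)).comp (X ^ (q + 1)) *
    (p * (p'.map (FiniteField.frobeniusAlgHom F K).toRingHom).comp (X ^ q))
  have hR : ∀ x : K, algebraMap F K (U.eval (Algebra.norm F x)) *
      (p.eval x * FiniteField.frobeniusAlgHom F K (p'.eval x)) = R.eval x := by
    intro x
    simp only [R, eval_mul, eval_comp, eval_pow, eval_X]
    congr 2
    · rw [pow_succ', ← FiniteField.frobeniusAlgHom_apply, ← algebraMap_norm_of_finrank_eq_two h2,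
        eval_map, eval₂_at_apply]
    · rw [← FiniteField.frobeniusAlgHom_apply F]
      exact (eval_map_apply (FiniteField.frobeniusAlgHom F K).toRingHom x).symm
  simp_rw [hR]
  refine sum_eval_eq_zero_of_natDegree_lt R ?_
  have h1 : R.natDegree ≤ U.natDegree * (q + 1) + ((d - 1) + (d - 1) * q) := by
    refine natDegree_mul_le.trans (add_le_add ?_ (natDegree_mul_le.trans (add_le_add (hdeg hp) ?_)))
    · refine natDegree_comp_le.trans ?_
      rw [natDegree_X_pow]
      exact Nat.mul_le_mul_right _ natDegree_map_le
    · refine natDegree_comp_le.trans ?_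
      rw [natDegree_X_pow]
      exact Nat.mul_le_mul_right _ (natDegree_map_le.trans (hdeg hp'))
  rw [hK]
  obtain ⟨c, rfl⟩ : ∃ c, d = c + 1 := ⟨d - 1, by omega⟩
  obtain ⟨m, hm⟩ : ∃ m, q = m + (U.natDegree + c + 2) := ⟨q - (U.natDegree + c + 2), by omega⟩
  rw [Nat.add_sub_cancel] at h1
  refine h1.trans_lt (Nat.lt_sub_of_add_lt ?_)
  nlinarith

/-- The subsystem codes supported on the points where a polynomial in the norm does not vanish. -/
theorem exists_subsystemCode_of_normPolynomial {q n κ r d s : ℕ} [DecidableEq F]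
    (hq : Fintype.card F = q) (h2 : Module.finrank F K = 2) (U : F[X])
    (hU : U.natDegree + d + 1 ≤ q)
    (hS : (Finset.univ.filter fun x : K => U.eval (Algebra.norm F x) ≠ 0).card = n + s)
    (hs : s ≤ d) (hn : n = κ + r + 2 * (d - s)) (hκ : 0 < κ) :
    ∃ Q : SubsystemCode q n (q ^ κ) (q ^ r), Q.HasMinDist (d - s + 1) := by
  classical
  set S := Finset.univ.filter fun x : K => U.eval (Algebra.norm F x) ≠ 0 with hSdef
  obtain ⟨P, hPS, hP⟩ := Finset.exists_subset_card_eq (s := S) (n := s) (by omega)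
  have hcard : (S \ P).card = n := by
    rw [Finset.card_sdiff_of_subset hPS]
    omega
  let ε : Fin n ≃ (S \ P : Finset K) := (Finset.equivFinOfCardEq hcard).symm
  -- Multiplication by `π` embeds degree < d - s into degree < d and kills the deleted points; its
  -- values elsewhere are absorbed into the weights.
  let π : K[X] := ∏ y ∈ P, (X - C y)
  have hπ : ∀ x, π.eval x = 0 ↔ x ∈ P := by
    intro x
    simp only [π, eval_prod, Finset.prod_eq_zero_iff, eval_sub, eval_X, eval_C, sub_eq_zero]
    exact ⟨fun ⟨y, hy, h⟩ => h ▸ hy, fun h => ⟨x, h, rfl⟩⟩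
  choose w hw using fun x : K => FiniteField.norm_surjective F K (U.eval (Algebra.norm F x))
  have hww : ∀ x, w x * FiniteField.frobeniusAlgHom F K (w x) =
      algebraMap F K (U.eval (Algebra.norm F x)) := by
    intro x
    rw [← algebraMap_norm_of_finrank_eq_two h2, hw]
  have hdeg : ∀ {p : K[X]}, p ∈ degreeLT K (d - s) → π * p ∈ degreeLT K d := by
    intro p hp
    rw [mem_degreeLT] at hp ⊢
    have hπd : π.degree = s := by
      simp only [π, degree_prod, degree_X_sub_C, Finset.sum_const, hP, nsmul_one]
    rw [degree_mul, hπd]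
    by_cases h0 : p = 0
    · simp [h0]
    · rw [degree_eq_natDegree h0] at hp ⊢
      have : p.natDegree < d - s := by exact_mod_cast hp
      exact_mod_cast (by omega : s + p.natDegree < d)
  refine exists_subsystemCode_of_grs hq h2 (fun i => (ε i : K))
    (Subtype.val_injective.comp ε.injective) (fun i => w (ε i) * π.eval (ε i : K)) ?_ hn hκ ?_
  · intro i
    have hi := Finset.mem_sdiff.mp (ε i).2
    refine mul_ne_zero (fun h0 => ?_) fun h0 => hi.2 ((hπ _).mp h0)
    refine (Finset.mem_filter.mp hi.1).2 ?_
    rw [← hw, h0, Algebra.norm_zero]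
  · intro p hp p' hp'
    have hsum := sum_norm_eval_mul_eq_zero h2 U (hq.symm ▸ hU) (hdeg hp) (hdeg hp')
    rw [← hsum, ← Finset.sum_subset (Finset.subset_univ (S \ P)), ← Finset.sum_coe_sort (S \ P),
      ← Equiv.sum_comp ε]
    · refine Finset.sum_congr rfl fun i _ => ?_
      rw [← hww]
      simp only [eval_mul, map_mul]
      ring
    · intro x _ hx
      rw [Finset.mem_sdiff, not_and_or, not_not] at hx
      rcases hx with hx | hx
      · have : U.eval (Algebra.norm F x) = 0 := by simpa [S] using hx
        simp [this]
      · simp [(hπ x).mpr hx]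

/-- The number of elements whose norm is a root of unity of given order. -/
lemma card_norm_pow_eq_one [DecidableEq F] (h2 : Module.finrank F K = 2) {e : ℕ} (he : 0 < e) :
    (Finset.univ.filter fun x : K => Algebra.norm F x ^ e = 1).card =
      (Fintype.card F + 1) * Nat.gcd (Fintype.card F - 1) e := by
  classical
  have hF : 1 < Fintype.card F := Fintype.one_lt_card
  have hK : Fintype.card K - 1 = (Fintype.card F + 1) * (Fintype.card F - 1) := by
    rw [Module.card_eq_pow_finrank (K := F) (V := K), h2]
    have := Nat.sq_sub_sq (Fintype.card F) 1
    simpa using this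
  have h := IsCyclic.card_powMonoidHom_ker Kˣ ((Fintype.card F + 1) * e)
  rw [Nat.card_units, Nat.card_eq_fintype_card (α := K), hK, Nat.gcd_mul_left] at h
  rw [← h, ← Fintype.card_subtype, ← Nat.card_eq_fintype_card]
  -- With N(x) = x^(q+1), the condition describes the kernel of a power map on the cyclic group of
  -- order (q+1)(q-1).
  have hiff : ∀ x : K, Algebra.norm F x ^ e = 1 ↔ x ^ ((Fintype.card F + 1) * e) = 1 := by
    intro x
    rw [← (algebraMap F K).injective.eq_iff, map_pow, map_one,
      algebraMap_norm_of_finrank_eq_two h2, FiniteField.frobeniusAlgHom_apply, ← pow_succ',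
      ← pow_mul]
  refine (Nat.card_congr (Equiv.ofBijective (fun u : (powMonoidHom ((Fintype.card F + 1) * e) :
    Kˣ →* Kˣ).ker => (⟨(u : Kˣ), (hiff _).mpr ?_⟩ : {x : K // Algebra.norm F x ^ e = 1}))
      ⟨fun u v huv => ?_, fun x => ?_⟩)).symm
  · have := congrArg Units.val (MonoidHom.mem_ker.mp u.2)
    simpa using this
  · exact Subtype.ext (Units.ext (congrArg Subtype.val huv))
  · have hx := (hiff x).mp x.2
    have hx0 : (x : K) ≠ 0 := by
      intro h0
      rw [h0, zero_pow (by positivity)] at hx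
      exact zero_ne_one hx
    refine ⟨⟨Units.mk0 x hx0, MonoidHom.mem_ker.mpr (Units.ext ?_)⟩, rfl⟩
    simpa using hx

end NormPolynomial

/-! ### Lengths of the codes and bookkeeping of the parameters. -/

section Parameters

open Polynomial

lemma card_norm_ne_zero {F K : Type*} [Field F] [Field K] [Fintype K] [Algebra F K]
    [DecidableEq F] :
    (Finset.univ.filter fun x : K => Algebra.norm F x ≠ 0).card + 1 = Fintype.card K := by
  classical
  have := Module.Finite.of_finite (R := F) (M := K)
  have h : (Finset.univ.filter fun x : K => Algebra.norm F x ≠ 0) = Finset.univ.erase 0 := by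
    ext x
    simp [Algebra.norm_eq_zero_iff]
  rw [h, Finset.card_erase_add_one (Finset.mem_univ _), Finset.card_univ]

lemma natDegree_one_sub_X_pow_le {F : Type*} [Field F] (e : ℕ) : (1 - X ^ e : F[X]).natDegree ≤ e :=
  (natDegree_sub_le _ _).trans (by simp)

variable {F K : Type*} [Field F] [Fintype F] [Field K] [Fintype K] [Algebra F K] [DecidableEq F]

/-- Here k = d + 1 is the distance before deleting `s` points. Only the sum of `κ` and `r` is
prescribed, so one `U` serves both members of each pair of families. -/
lemma existsOptimalSubsystemCode_of_normPolynomial {q : ℕ} (hq : Fintype.card F = q)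
    (h2 : Module.finrank F K = 2) (U : F[X]) {k s : ℕ} (hk : 0 < k) (hU : U.natDegree + k ≤ q)
    (hs : s ≤ k - 1) {N n κ r δ : ℤ}
    (hN : ((Finset.univ.filter fun x : K => U.eval (Algebra.norm F x) ≠ 0).card : ℤ) = N)
    (hn : n = N - s) (hδ : δ = k - s) (hκ : 0 < κ) (hr : 0 ≤ r)
    (hsum : κ + r = N + s - 2 * k + 2) : ExistsOptimalSubsystemCode q n κ r δ := by
  obtain ⟨d, rfl⟩ : ∃ d, k = d + 1 := ⟨k - 1, by omega⟩
  rw [Nat.add_sub_cancel] at hs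
  push_cast at hsum hδ
  lift κ to ℕ using hκ.le
  lift r to ℕ using hr
  lift n to ℕ using by omega
  refine ⟨⟨n, κ, r, d - s + 1, rfl, rfl, rfl, by omega, ?_⟩, by omega⟩
  exact exists_subsystemCode_of_normPolynomial hq h2 U (by omega) (by omega) hs (by omega)
    (by omega)

lemma card_norm_pow_ne_one (h2 : Module.finrank F K = 2) {e : ℕ} (he : 0 < e) :
    (Finset.univ.filter fun x : K => 1 - Algebra.norm F x ^ e ≠ 0).card +
      (Fintype.card F + 1) * Nat.gcd (Fintype.card F - 1) e = Fintype.card K := by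
  rw [← card_norm_pow_eq_one (K := K) h2 he, add_comm, ← Finset.card_univ,
    ← Finset.card_filter_add_card_filter_not (s := Finset.univ) (fun x : K => Algebra.norm F x ^ e = 1)]
  refine congrArg₂ (· + ·) rfl (congrArg Finset.card ?_)
  ext x
  simp [sub_eq_zero, eq_comm (a := (1 : F))]

lemma card_norm_mul_ne_zero (h2 : Module.finrank F K = 2) {e : ℕ} (he : 0 < e) :
    (Finset.univ.filter fun x : K =>
      Algebra.norm F x * (1 - Algebra.norm F x ^ e) ≠ 0).card + 1 +
      (Fintype.card F + 1) * Nat.gcd (Fintype.card F - 1) e = Fintype.card K := by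
  classical
  rw [← card_norm_pow_ne_one (K := K) h2 he]
  congr 1
  have := Module.Finite.of_finite (R := F) (M := K)
  have h : (Finset.univ.filter fun x : K => Algebra.norm F x * (1 - Algebra.norm F x ^ e) ≠ 0) =
      (Finset.univ.filter fun x : K => 1 - Algebra.norm F x ^ e ≠ 0).erase 0 := by
    ext x
    simp [Algebra.norm_eq_zero_iff]
  rw [h, Finset.card_erase_add_one]
  simp [he.ne']

end Parameters

/-! ### The four choices of the norm polynomial. -/

/-- A proper divisor of b is at most b / 2. This keeps `κ` positive in the families whose length
involves a gcd. -/
lemma two_mul_gcd_le {a b : ℕ} (ha : 0 < a) (hab : a < b) : 2 * Nat.gcd a b ≤ b := by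
  obtain ⟨c, hc⟩ := Nat.gcd_dvd_right a b
  have h1 : Nat.gcd a b ≤ a := Nat.gcd_le_left b ha
  have h2 : 2 ≤ c := by
    by_contra! h
    interval_cases c <;> omega
  calc 2 * Nat.gcd a b ≤ c * Nat.gcd a b := Nat.mul_le_mul_right _ h2
    _ = b := by rw [mul_comm, ← hc]

lemma exists_quadratic_extension {q : ℕ} (hq : IsPrimePow q) :
    ∃ (F K : Type) (_ : Field F) (_ : Fintype F) (_ : Field K) (_ : Fintype K) (_ : Algebra F K),
      Fintype.card F = q ∧ Module.finrank F K = 2 := by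
  obtain ⟨p, t, hp, ht, rfl⟩ := hq
  have : Fact p.Prime := ⟨hp.nat_prime⟩
  refine ⟨GaloisField p t, FiniteField.Extension (GaloisField p t) p 2, inferInstance,
    Fintype.ofFinite _, inferInstance, Fintype.ofFinite _, inferInstance, ?_,
    FiniteField.finrank_extension _ _ _⟩
  rw [Fintype.card_eq_nat_card, GaloisField.card p t ht.ne']

open Polynomial in
theorem theorem12 (q : ℕ) (hq : IsPrimePow q) :
    (∀ s : ℕ, s ≤ q - 1 →
      ExistsOptimalSubsystemCode q (q ^ 2 - s) (q ^ 2 - 2 * q + 1) (1 + s) (q - s) ∧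
      ExistsOptimalSubsystemCode q (q ^ 2 - s) (q ^ 2 - 2 * q + 1 + s) 1 (q - s)) ∧
    (∀ k : ℕ, 1 < k → k < q →
      (∀ s : ℕ, s ≤ k - 1 →
        ExistsOptimalSubsystemCode q (q ^ 2 - 1 - s) (q ^ 2 - 2 * k) (1 + s) (k - s) ∧
        ExistsOptimalSubsystemCode q (q ^ 2 - 1 - s) (q ^ 2 - 2 * k + s) 1 (k - s)) ∧
      (∀ i : ℕ, i = Nat.gcd (k - 1) (q - 1) → ∀ s : ℕ, s ≤ k - 1 →
        ExistsOptimalSubsystemCode q (q ^ 2 - i * (q + 1) - s)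
          (q ^ 2 - i * (q + 1) - 2 * k + 1) (1 + s) (k - s) ∧
        ExistsOptimalSubsystemCode q (q ^ 2 - i * (q + 1) - s)
          (q ^ 2 - i * (q + 1) - 2 * k + 1 + s) 1 (k - s)) ∧
      (∀ m : ℕ, k - 1 < m → m < q - 1 →
        ∀ j : ℕ, j = Nat.gcd (m - k + 1) (q - 1) → ∀ s : ℕ, s ≤ k - 1 →
        ExistsOptimalSubsystemCode q (q ^ 2 - j * (q + 1) - 1 - s)
          (q ^ 2 - j * (q + 1) - 2 * k) (1 + s) (k - s) ∧
        ExistsOptimalSubsystemCode q (q ^ 2 - j * (q + 1) - 1 - s)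
          (q ^ 2 - j * (q + 1) - 2 * k + s) 1 (k - s))) := by
  classical
  have hq2 : 2 ≤ q := hq.two_le
  have hq2' : (2 : ℤ) ≤ q := by exact_mod_cast hq2
  obtain ⟨F, K, _, _, _, _, _, hF, h2⟩ := exists_quadratic_extension hq
  have hK : (Fintype.card K : ℤ) = (q : ℤ) ^ 2 := by
    rw [Module.card_eq_pow_finrank (K := F) (V := K), h2, hF]
    push_cast
    rfl
  refine ⟨fun s hs => ?_, fun k hk1 hkq => ⟨fun s hs => ?_, fun i hi s hs => ?_,
    fun m hkm hmq j hj s hs => ?_⟩⟩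
  · have hN : ((Finset.univ.filter fun x : K =>
        (1 : F[X]).eval (Algebra.norm F x) ≠ 0).card : ℤ) = (q : ℤ) ^ 2 := by
      simpa using hK
    have hκ : (0 : ℤ) < q ^ 2 - 2 * q + 1 := by nlinarith
    constructor <;>
    exact existsOptimalSubsystemCode_of_normPolynomial hF h2 1 (by omega) (by simp) hs hN
      rfl rfl (by omega) (by omega) (by ring)
  · have hN : ((Finset.univ.filter fun x : K =>
        (X : F[X]).eval (Algebra.norm F x) ≠ 0).card : ℤ) = (q : ℤ) ^ 2 - 1 := by
      rw [← hK, ← card_norm_ne_zero (F := F) (K := K)]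
      simp
    have hκ : (0 : ℤ) < q ^ 2 - 2 * k := by
      have : (k : ℤ) + 1 ≤ q := by exact_mod_cast hkq
      nlinarith
    constructor <;>
    exact existsOptimalSubsystemCode_of_normPolynomial hF h2 X (by omega)
      (by rw [natDegree_X]; omega) hs hN rfl rfl (by omega) (by omega) (by ring)
  · have hgcd : Nat.gcd (q - 1) (q - k) = i := by
      rw [hi, Nat.gcd_comm (k - 1), show q - k = (q - 1) - (k - 1) by omega,
        Nat.gcd_self_sub_right (by omega)]
    have hN : ((Finset.univ.filter fun x : K =>
        (1 - X ^ (q - k) : F[X]).eval (Algebra.norm F x) ≠ 0).card : ℤ) =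
          (q : ℤ) ^ 2 - i * (q + 1) := by
      rw [← hK, ← card_norm_pow_ne_one (F := F) (K := K) h2 (e := q - k) (by omega), hF, hgcd]
      push_cast
      simp only [eval_sub, eval_one, eval_pow, eval_X]
      ring
    have hκ : (0 : ℤ) < q ^ 2 - i * (q + 1) - 2 * k + 1 := by
      have h1 : (k : ℤ) + 1 ≤ q := by exact_mod_cast hkq
      have h3 : 2 * (i : ℤ) ≤ q - 1 := by
        have := two_mul_gcd_le (a := k - 1) (b := q - 1) (by omega) (by omega)
        omega
      -- With 2i ≤ q - 1 and k ≤ q - 1 the quantity is at least ((q - 2)² + 3) / 2.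
      nlinarith [sq_nonneg ((q : ℤ) - 2)]
    constructor <;>
    exact existsOptimalSubsystemCode_of_normPolynomial hF h2 (1 - X ^ (q - k)) (by omega)
      (by have := natDegree_one_sub_X_pow_le (F := F) (q - k); omega) hs hN rfl rfl (by omega)
      (by omega) (by ring)
  · have hgcd : Nat.gcd (q - 1) (m - k + 1) = j := by rw [hj, Nat.gcd_comm]
    have hN : ((Finset.univ.filter fun x : K =>
        (X * (1 - X ^ (m - k + 1)) : F[X]).eval (Algebra.norm F x) ≠ 0).card : ℤ) =
          (q : ℤ) ^ 2 - j * (q + 1) - 1 := by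
      rw [← hK, ← card_norm_mul_ne_zero (F := F) (K := K) h2 (e := m - k + 1) (by omega), hF, hgcd]
      push_cast
      simp only [eval_mul, eval_sub, eval_one, eval_pow, eval_X]
      ring
    have hκ : (0 : ℤ) < q ^ 2 - j * (q + 1) - 2 * k := by
      have h1 : (j : ℤ) + k + 1 ≤ q := by
        have := Nat.gcd_le_left (m := m - k + 1) (q - 1) (by omega)
        omega
      have h3 : 2 * (j : ℤ) ≤ q - 1 := by
        have := two_mul_gcd_le (a := m - k + 1) (b := q - 1) (by omega) (by omega)
        omega
      -- Bounding k by q - 1 - j leaves (q - 1)² + 1 - j(q - 1), which is at least (q - 1)² / 2 + 1.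
      nlinarith [mul_nonneg (sub_nonneg.mpr h3) (by linarith : (0 : ℤ) ≤ q - 1)]
    -- The degree is at most m - k + 2, so adding k gives at most m + 2 ≤ q; this is where m < q - 1
    -- enters.
    have hdeg : (X * (1 - X ^ (m - k + 1)) : F[X]).natDegree ≤ 1 + (m - k + 1) :=
      natDegree_mul_le.trans (add_le_add natDegree_X_le (natDegree_one_sub_X_pow_le _))
    constructor <;>
    exact existsOptimalSubsystemCode_of_normPolynomial hF h2 (X * (1 - X ^ (m - k + 1)))
      (by omega) (by omega) hs hN rfl rfl (by omega) (by omega) (by ring)
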